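/- All Hilbert spaces are finite-dimensional, of arbitrary dimension. A state is a positive semidefinite operator of unit trace; a measurement is a finite family of positive semidefinite operators summing to the identity, binary if it has two outcomes, indexed by $0,1$, and projective if its elements are projectors. For a state $\rho_A$ and measurements $\mathsf X=\{M^x\}$, $\mathsf Y=\{N^y\}$ on $A$, the effective overlap is $$c^*(\rho_A,\mathsf X,\mathsf Y)=\inf\ \sum_k \operatorname{tr}(P^kU\rho_AU^\dagger)\,\max_x\Big\|\sum_y P^kN'^yP^k\cdot P^kM'^xP^k\cdot P^kN'^yP^k\Big\|,$$ where $\|\cdot\|$ is the operator norm and the infimum is over all embeddings (isometries) $U:A\to A'$, all measurements $\{M'^x\}$, $\{N'^y\}$ on $A'$ and all projective measurements $\{P^k\}$ on $A'$ such that $\sum_kU^\dagger P^kM'^xP^kU=M^x$ and $\sum_kU^\dagger P^kN'^yP^kU=N^y$ for all $x,y$. For a state $\rho_{AD}$, binary measurements $\mathsf X=\{M^i\}$, $\mathsf Y=\{N^i\}$ on $A$ and $\mathsf R=\{R^i\}$, $\mathsf S=\{S^i\}$ on $D$, the CHSH value is $$\beta(\rho_{AD},\mathsf X,\mathsf Y,\mathsf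 R,\mathsf S)=2\operatorname{tr}\Big(\sum_{i=0}^1\big(M^i\otimes(R^i+S^i)+N^i\otimes(R^i+S^{1-i})\big)\rho_{AD}\Big)-4.$$ **Theorem.** Let $\rho_A$ be a state, let $\mathsf X,\mathsf Y$ be binary measurements on $A$, and let $c^*=c^*(\rho_A,\mathsf X,\mathsf Y)$; then $0\le c^*\le 1$. For every state $\rho_{AD}$ with $\operatorname{tr}_D\rho_{AD}=\rho_A$ and all binary measurements $\mathsf R,\mathsf S$ on $D$, the CHSH value $\beta=\beta(\rho_{AD},\mathsf X,\mathsf Y,\mathsf R,\mathsf S)$ satisfies $$\beta\le 2\big(\sqrt{c^*}+\sqrt{1-c^*}\big).$$ Conversely, for every bipartite state $\rho_{AD}$ with marginal $\rho_A=\operatorname{tr}_D\rho_{AD}$ and all binary measurements $\mathsf X,\mathsf Y$ on $A$ and $\mathsf R,\mathsf S$ on $D$ whose CHSH value $\beta=\beta(\rho_{AD},\mathsf X,\mathsf Y,\mathsf R,\mathsf S)$ is at least $2$, $$c^*(\rho_A,\mathsf X,\mathsf Y)\le\frac12+\frac{\beta}{8}\sqrt{8-\beta^2}.$$ -/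

import Mathlib

open scoped Matrix Kronecker ComplexOrder

/-- A quantum state on the finite-dimensional Hilbert space with orthonormal basis `a`:
a positive semidefinite matrix with unit trace. -/
structure IsQState {a : Type*} [Fintype a] (ρ : Matrix a a ℂ) : Prop where
  posSemidef : ρ.PosSemidef
  trace_eq_one : ρ.trace = 1

/-- A measurement (POVM) with outcomes in the finite set `o`: positive semidefinite matrices
that sum to the identity. -/
structure IsMeasurement {o a : Type*} [Fintype o] [Fintype a] [DecidableEq a]
    (M : o → Matrix a a ℂ) : Prop where
  posSemidef : ∀ x, (M x).PosSemidef
  sum_eq_one : ∑ x, M x = 1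

/-- A projective measurement: a measurement whose elements are projectors. -/
structure IsProjMeasurement {o a : Type*} [Fintype o] [Fintype a] [DecidableEq a]
    (P : o → Matrix a a ℂ) : Prop where
  isMeasurement : IsMeasurement P
  idem : ∀ k, P k * P k = P k

/-- The operator norm of a matrix acting on a finite-dimensional Hilbert space. -/
noncomputable def qOpNorm {a : Type*} [Fintype a] [DecidableEq a] (T : Matrix a a ℂ) : ℝ :=
  ‖Matrix.toEuclideanCLM (n := a) (𝕜 := ℂ) T‖

/-- The partial trace over the second tensor factor. -/
def partialTraceRight {a d : Type*} [Fintype d] (ρ : Matrix (a × d) (a × d) ℂ) :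
    Matrix a a ℂ :=
  Matrix.of fun i j => ∑ k, ρ (i, k) (j, k)

/-- The data `(U, X', Y', K')` of an embedding `U` (an isometry into a larger space), two
measurements `M'`, `N'` and a projective measurement `P` on the larger space, which reproduce the
measurements `M` and `N` when `P` is measured first. -/
structure IsJointDilation {ι κ σ a a' : Type*} [Fintype ι] [Fintype κ] [Fintype σ]
    [Fintype a] [DecidableEq a] [Fintype a'] [DecidableEq a']
    (M : ι → Matrix a a ℂ) (N : κ → Matrix a a ℂ) (U : Matrix a' a ℂ)
    (M' : ι → Matrix a' a' ℂ) (N' : κ → Matrix a' a' ℂ) (P : σ → Matrix a' a' ℂ) : Prop where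
  isometry : Uᴴ * U = 1
  left : IsMeasurement M'
  right : IsMeasurement N'
  proj : IsProjMeasurement P
  left_eq : ∀ x, ∑ k, Uᴴ * P k * M' x * P k * U = M x
  right_eq : ∀ y, ∑ k, Uᴴ * P k * N' y * P k * U = N y

/-- The average overlap of `M'` and `N'` on the state `ρ'` sliced by `P`. -/
noncomputable def slicedOverlap {ι κ σ a' : Type*} [Fintype κ] [Fintype σ]
    [Fintype a'] [DecidableEq a'] (ρ' : Matrix a' a' ℂ)
    (M' : ι → Matrix a' a' ℂ) (N' : κ → Matrix a' a' ℂ) (P : σ → Matrix a' a' ℂ) : ℝ :=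
  ∑ k, (P k * ρ').trace.re *
    ⨆ x, qOpNorm (∑ y, (P k * N' y * P k) * (P k * M' x * P k) * (P k * N' y * P k))

/-- The effective overlap `c*(ρ, M, N)`: the infimum of the sliced overlap over all embeddings
into a finite-dimensional space `ℂⁿ`, measurements `M'`, `N'` and projective measurements
`P` (with any finite number `s` of outcomes) that reproduce `M` and `N`. -/
noncomputable def effectiveOverlap {ι κ a : Type*} [Fintype ι] [Fintype κ]
    [Fintype a] [DecidableEq a] (ρ : Matrix a a ℂ)
    (M : ι → Matrix a a ℂ) (N : κ → Matrix a a ℂ) : ℝ :=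
  sInf {c : ℝ | ∃ (n s : ℕ) (U : Matrix (Fin n) a ℂ)
    (M' : ι → Matrix (Fin n) (Fin n) ℂ) (N' : κ → Matrix (Fin n) (Fin n) ℂ)
    (P : Fin s → Matrix (Fin n) (Fin n) ℂ),
    IsJointDilation M N U M' N' P ∧ c = slicedOverlap (U * ρ * Uᴴ) M' N' P}

/-- The CHSH value of a bipartite state `ρ` and binary measurements `M`, `N` on the first and
`R`, `S` on the second system. In `Fin 2` the outcome `1 - i` is the one opposite to `i`. -/
noncomputable def chshValue {a d : Type*} [Fintype a] [Fintype d]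
    (ρ : Matrix (a × d) (a × d) ℂ) (M N : Fin 2 → Matrix a a ℂ)
    (R S : Fin 2 → Matrix d d ℂ) : ℝ :=
  2 * ((∑ i, (M i ⊗ₖ (R i + S i) + N i ⊗ₖ (R i + S (1 - i)))) * ρ).trace.re - 4

/-! Two estimates carry the theorem. The first (`exists_effectiveOverlap_le`) bounds c* from above
by one good dilation. Halmos dilations turn both observables into involutions A, B on one larger
space. Their anticommutator AB + BA commutes with A and B, so its spectral projectors P_k, with
eigenvalues μ_k, form an admissible slicing. On each block (A ± B)² is the scalar 2 ± μ_k and the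
overlap is at most 1/2 + |μ_k|/4. With weights p_k and t = ∑ p_k |μ_k| this gives c* ≤ 1/2 + t/4,
while Cauchy-Schwarz, in each block and then over the blocks, gives β ≤ √(2 + t) + √(2 - t).
Eliminating t yields the converse, and also the bound on β if c* ≥ 1/2, where √c + √(1 - c)
decreases.

For c* ≤ 1/2 a lower bound on the overlap of every dilation is needed. With B₀ the observable of Y
on the original space, β ≤ 2√(1 + ⟨B₀²⟩), while every dilation has overlap at least (1 + ⟨B₀²⟩)/4.
So β ≤ 4√c* (`chshValue_le_four_mul_sqrt_effectiveOverlap`), and √c* ≤ √(1 - c*) finishes. -/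

/-- The real part of the expectation value of the operator `T` in the state `ρ`. -/
noncomputable def expval {a : Type*} [Fintype a] (ρ : Matrix a a ℂ) : Matrix a a ℂ →ₗ[ℝ] ℝ where
  toFun T := (T * ρ).trace.re
  map_add' S T := by simp [add_mul]
  map_smul' r T := by simp

/-! ### Expectation values and Cauchy-Schwarz -/

section Expval

variable {a b d : Type*} [Fintype a] [Fintype b] [Fintype d]

lemma expval_apply (ρ T : Matrix a a ℂ) : expval ρ T = (T * ρ).trace.re := rfl

lemma expval_nonneg {ρ T : Matrix a a ℂ} (hρ : ρ.PosSemidef) (hT : T.PosSemidef) :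
    0 ≤ expval ρ T := by
  classical
  obtain ⟨G, rfl⟩ : ∃ G : Matrix a a ℂ, ρ = Gᴴ * G := by
    open scoped MatrixOrder in
    exact CStarAlgebra.nonneg_iff_eq_star_mul_self.1 hρ.nonneg
  rw [expval_apply, ← mul_assoc, Matrix.trace_mul_comm, ← mul_assoc]
  exact (Complex.le_def.1 (hT.mul_mul_conjTranspose_same G).trace_nonneg).1

lemma expval_conj (ρ : Matrix a a ℂ) (T : Matrix b b ℂ) (V : Matrix b a ℂ) :
    expval ρ (Vᴴ * T * V) = expval (V * ρ * Vᴴ) T := by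
  rw [expval_apply, expval_apply, Matrix.mul_assoc, Matrix.mul_assoc, Matrix.trace_mul_comm,
    Matrix.mul_assoc]

lemma expval_kronecker_one [DecidableEq d] (ρ : Matrix (a × d) (a × d) ℂ) (T : Matrix a a ℂ) :
    expval ρ (T ⊗ₖ 1) = expval (partialTraceRight ρ) T := by
  simp only [expval_apply, Matrix.trace, Matrix.diag, Matrix.mul_apply, partialTraceRight,
    Matrix.of_apply, Fintype.sum_prod_type, Matrix.kroneckerMap_apply, Matrix.one_apply, mul_ite,
    mul_one, mul_zero, ite_mul, zero_mul, Finset.sum_ite_eq, Finset.mem_univ, if_true,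
    Finset.mul_sum]
  congr 1
  exact Finset.sum_congr rfl fun i _ => Finset.sum_comm

lemma IsQState.expval_one [DecidableEq a] {ρ : Matrix a a ℂ} (h : IsQState ρ) :
    expval ρ 1 = 1 := by
  simp [expval_apply, h.trace_eq_one]

lemma expval_mono {ρ S T : Matrix a a ℂ} (hρ : ρ.PosSemidef) (h : (T - S).PosSemidef) :
    expval ρ S ≤ expval ρ T := by
  have := expval_nonneg hρ h
  rw [map_sub] at this
  linarith

lemma expval_mul_self_nonneg {ρ Z : Matrix a a ℂ} (hρ : ρ.PosSemidef) (hZ : Z.IsHermitian) :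
    0 ≤ expval ρ (Z * Z) := by
  have := Matrix.posSemidef_conjTranspose_mul_self Z
  rw [hZ.eq] at this
  exact expval_nonneg hρ this

/-- Cauchy-Schwarz inequality for a product observable supported on the projector `P`. -/
lemma expval_kronecker_sq_le [DecidableEq d] {ρ : Matrix (a × d) (a × d) ℂ}
    (hρ : ρ.PosSemidef) {X P : Matrix a a ℂ} {C : Matrix d d ℂ} (hX : X.IsHermitian)
    (hP : P.IsHermitian) (hPP : P * P = P) (hPX : P * X = X) (hXP : X * P = X)
    (hC : C.IsHermitian) (hCC : (1 - C * C).PosSemidef) :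
    expval ρ (X ⊗ₖ C) ^ 2 ≤ expval ρ ((X * X) ⊗ₖ 1) * expval ρ (P ⊗ₖ 1) := by
  have hPsd : P.PosSemidef := by
    have := Matrix.posSemidef_conjTranspose_mul_self P
    rwa [hP.eq, hPP] at this
  have hC1 : expval ρ (P ⊗ₖ (C * C)) ≤ expval ρ (P ⊗ₖ 1) := by
    refine expval_mono hρ ?_
    have e : P ⊗ₖ (1 : Matrix d d ℂ) - P ⊗ₖ (C * C) = P ⊗ₖ (1 - C * C) := by
      ext ⟨i, j⟩ ⟨k, l⟩
      simp [mul_sub]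
    rw [e]
    exact hPsd.kronecker hCC
  -- This is ⟨(X ⊗ 1 - s P ⊗ C)²⟩ ≥ 0 with C² replaced by its upper bound 1; the discriminant of the
  -- quadratic in s is the claim.
  have key : ∀ s : ℝ, 0 ≤ expval ρ (P ⊗ₖ 1) * (s * s) + (-2 * expval ρ (X ⊗ₖ C)) * s
      + expval ρ ((X * X) ⊗ₖ 1) := by
    intro s
    have hZ : (X ⊗ₖ (1 : Matrix d d ℂ) - s • (P ⊗ₖ C)).IsHermitian := by
      rw [Matrix.IsHermitian, Matrix.conjTranspose_sub, Matrix.conjTranspose_smul,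
        Matrix.conjTranspose_kronecker, Matrix.conjTranspose_kronecker, hX.eq, hP.eq, hC.eq,
        Matrix.conjTranspose_one, star_trivial]
    have h := expval_mul_self_nonneg hρ hZ
    have e : (X ⊗ₖ (1 : Matrix d d ℂ) - s • (P ⊗ₖ C)) * (X ⊗ₖ (1 : Matrix d d ℂ) - s • (P ⊗ₖ C))
        = (X * X) ⊗ₖ 1 - (2 * s) • (X ⊗ₖ C) + (s * s) • (P ⊗ₖ (C * C)) := by
      simp only [sub_mul, mul_sub, smul_mul_assoc, mul_smul_comm, ← Matrix.mul_kronecker_mul,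
        mul_one, one_mul, hPX, hXP, hPP]
      module
    rw [e, map_add, map_sub, map_smul, map_smul, smul_eq_mul, smul_eq_mul] at h
    nlinarith [mul_self_nonneg s]
  have := discrim_le_zero key
  rw [discrim] at this
  nlinarith

lemma expval_kronecker_le_sqrt [DecidableEq d] {ρ : Matrix (a × d) (a × d) ℂ}
    (hρ : ρ.PosSemidef) {X P : Matrix a a ℂ} {C : Matrix d d ℂ} (hX : X.IsHermitian)
    (hP : P.IsHermitian) (hPP : P * P = P) (hPX : P * X = X) (hXP : X * P = X)
    (hC : C.IsHermitian) (hCC : (1 - C * C).PosSemidef) :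
    expval ρ (X ⊗ₖ C) ≤ √(expval ρ ((X * X) ⊗ₖ 1) * expval ρ (P ⊗ₖ 1)) :=
  Real.le_sqrt_of_sq_le (expval_kronecker_sq_le hρ hX hP hPP hPX hXP hC hCC)

end Expval

/-! ### Operator norm -/

section OpNorm

variable {a : Type*} [Fintype a] [DecidableEq a]

lemma qOpNorm_nonneg (T : Matrix a a ℂ) : 0 ≤ qOpNorm T := norm_nonneg _

lemma qOpNorm_add_le (S T : Matrix a a ℂ) : qOpNorm (S + T) ≤ qOpNorm S + qOpNorm T := by
  simpa only [qOpNorm, map_add] using norm_add_le _ _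

lemma qOpNorm_real_smul (r : ℝ) (T : Matrix a a ℂ) : qOpNorm (r • T) = |r| * qOpNorm T := by
  have : r • T = (r : ℂ) • T := by ext; simp
  rw [this, qOpNorm, map_smul, norm_smul, Complex.norm_real, Real.norm_eq_abs, qOpNorm]

/-- The C*-identity gives ‖P‖² = ‖P‖, hence ‖P‖ ≤ 1, and ‖T‖² = ‖P‖. -/
lemma qOpNorm_le_one_of_conjTranspose_mul_self_idem {T P : Matrix a a ℂ}
    (hP : P.IsHermitian) (hPP : P * P = P) (h : Tᴴ * T = P) : qOpNorm T ≤ 1 := by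
  have key : ∀ S Q : Matrix a a ℂ, Sᴴ * S = Q → qOpNorm S * qOpNorm S = qOpNorm Q := by
    intro S Q hS
    simp only [qOpNorm]
    rw [← CStarRing.norm_star_mul_self, ← map_star, ← map_mul, Matrix.star_eq_conjTranspose, hS]
  have h1 := key T P h
  have h2 := key P P (by rw [hP.eq, hPP])
  have h3 : qOpNorm P ≤ 1 := by nlinarith [qOpNorm_nonneg P]
  nlinarith [qOpNorm_nonneg T]

lemma posSemidef_qOpNorm_sub {T : Matrix a a ℂ} (hT : T.IsHermitian) :
    (qOpNorm T • (1 : Matrix a a ℂ) - T).PosSemidef := by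
  have hH : (qOpNorm T • (1 : Matrix a a ℂ) - T).IsHermitian := by
    rw [Matrix.IsHermitian, Matrix.conjTranspose_sub, Matrix.conjTranspose_smul, hT.eq]
    simp
  refine Matrix.PosSemidef.of_dotProduct_mulVec_nonneg hH fun x => ?_
  have him := hH.im_star_dotProduct_mulVec_self x
  rw [Complex.nonneg_iff]
  refine ⟨?_, him.symm⟩
  set y : EuclideanSpace ℂ a := WithLp.toLp 2 x with hy
  have h1 : (star x ⬝ᵥ T *ᵥ x).re ≤ qOpNorm T * ‖y‖ ^ 2 := by
    have e : star x ⬝ᵥ T *ᵥ x = inner ℂ y (Matrix.toEuclideanCLM (n := a) (𝕜 := ℂ) T y) := by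
      rw [EuclideanSpace.inner_eq_star_dotProduct, Matrix.ofLp_toEuclideanCLM, dotProduct_comm]
    rw [e]
    calc _ ≤ ‖inner ℂ y (Matrix.toEuclideanCLM (n := a) (𝕜 := ℂ) T y)‖ := Complex.re_le_norm _
      _ ≤ ‖y‖ * ‖Matrix.toEuclideanCLM (n := a) (𝕜 := ℂ) T y‖ := norm_inner_le_norm _ _
      _ ≤ ‖y‖ * (qOpNorm T * ‖y‖) := by
        gcongr
        exact ContinuousLinearMap.le_opNorm _ _
      _ = _ := by ring
  have h2 : (star x ⬝ᵥ x).re = ‖y‖ ^ 2 := by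
    have : star x ⬝ᵥ x = inner ℂ y y := by
      rw [EuclideanSpace.inner_eq_star_dotProduct, dotProduct_comm]
    rw [this, inner_self_eq_norm_sq_to_K]
    norm_cast
  rw [Matrix.sub_mulVec, Matrix.smul_mulVec, Matrix.one_mulVec, dotProduct_sub,
    dotProduct_smul, Complex.sub_re, Complex.real_smul, Complex.re_ofReal_mul, h2]
  linarith

lemma expval_le_qOpNorm_mul {ρ T : Matrix a a ℂ} (hρ : ρ.PosSemidef) (hT : T.IsHermitian) :
    expval ρ T ≤ qOpNorm T * expval ρ 1 := by
  have := expval_mono hρ (posSemidef_qOpNorm_sub hT)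
  rwa [map_smul, smul_eq_mul] at this

end OpNorm

/-! ### Square roots, spectral projectors and dilations -/

section Hermitian

variable {a : Type*} [Fintype a] [DecidableEq a]

/-- The commutation clause is what cancels the off-diagonal blocks in the Halmos dilation. -/
lemma Matrix.PosSemidef.exists_isHermitian_sqrt {H : Matrix a a ℂ} (hH : H.PosSemidef) :
    ∃ S : Matrix a a ℂ, S.IsHermitian ∧ S * S = H ∧ ∀ B, Commute H B → Commute S B := by
  open scoped MatrixOrder in
  exact ⟨CFC.sqrt H, (Matrix.nonneg_iff_posSemidef.1 (CFC.sqrt_nonneg H)).1,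
     CFC.sqrt_mul_sqrt_self H hH.nonneg,
    fun B hB => by rw [CFC.sqrt_eq_cfc]; exact hB.cfc_nnreal _⟩

/-- The spectral decomposition of a Hermitian matrix into projectors that commute with everything
the matrix commutes with. -/
lemma Matrix.IsHermitian.exists_spectral_projections {K : Matrix a a ℂ} (hK : K.IsHermitian) :
    ∃ (s : ℕ) (P : Fin s → Matrix a a ℂ) (μ : Fin s → ℝ), IsProjMeasurement P ∧
      (∀ k, K * P k = μ k • P k) ∧ ∀ B, Commute K B → ∀ k, Commute (P k) B := by
  classical
  have hsa : IsSelfAdjoint K := hK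
  have hfin : (spectrum ℝ K).Finite := K.finite_real_spectrum
  -- The spectrum is finite, so indicators of single eigenvalues are admissible in the functional
  -- calculus.
  have hcont : ∀ f : ℝ → ℝ, ContinuousOn f (spectrum ℝ K) := fun f => hfin.continuousOn f
  have : Fintype (spectrum ℝ K) := hfin.fintype
  let e := (Fintype.equivFin (spectrum ℝ K)).symm
  let f : Fin (Fintype.card (spectrum ℝ K)) → ℝ → ℝ := fun k x => if x = e k then 1 else 0
  have hidem : ∀ k, cfc (f k) K * cfc (f k) K = cfc (f k) K := fun k => by
    rw [← cfc_mul _ _ K (hcont _) (hcont _)]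
    congr 1
    ext x
    simp [f]
  have hherm : ∀ k, (cfc (f k) K)ᴴ = cfc (f k) K := fun k => (cfc_predicate (f k) K).star_eq
  refine ⟨_, fun k => cfc (f k) K, fun k => e k, ⟨⟨fun k => ?_, ?_⟩, hidem⟩, fun k => ?_,
    fun B hB k => hB.cfc_real _⟩
  · have := Matrix.posSemidef_conjTranspose_mul_self (cfc (f k) K)
    rwa [hherm, hidem] at this
  · rw [← cfc_sum_univ f K fun k => hcont _, ← cfc_one ℝ K]
    refine cfc_congr fun x hx => ?_
    rw [Finset.sum_apply, Finset.sum_eq_single (e.symm ⟨x, hx⟩)]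
    · simp [f]
    · intro k _ hk
      refine if_neg fun h => hk ?_
      rw [Equiv.eq_symm_apply]
      exact Subtype.ext h.symm
    · simp
  · calc K * cfc (f k) K = cfc id K * cfc (f k) K := by rw [cfc_id ℝ K]
      _ = cfc (fun x => (e k : ℝ) * f k x) K := by
        rw [← cfc_mul _ _ K (hcont _) (hcont _)]
        congr 1
        ext x
        by_cases h : x = e k <;> simp [f, h]
      _ = _ := cfc_const_mul _ _ K (hcont _)

/-- The Halmos dilation of a Hermitian contraction. -/
lemma exists_involution_toBlocks₁₁_eq {A : Matrix a a ℂ} (hA : A.IsHermitian)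
    (hAA : (1 - A * A).PosSemidef) :
    ∃ A' : Matrix (a ⊕ a) (a ⊕ a) ℂ, A'.IsHermitian ∧ A' * A' = 1 ∧ A'.toBlocks₁₁ = A := by
  obtain ⟨S, hS, hSS, hcomm⟩ := hAA.exists_isHermitian_sqrt
  have hSA : S * A = A * S := hcomm A (by simp [commute_iff_eq, sub_mul, mul_sub, mul_assoc])
  refine ⟨Matrix.fromBlocks A S S (-A), ?_, ?_, by simp⟩
  · rw [Matrix.IsHermitian, Matrix.fromBlocks_conjTranspose, hA.eq, hS.eq,
      Matrix.conjTranspose_neg, hA.eq]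
  · rw [Matrix.fromBlocks_multiply, hSS, ← Matrix.fromBlocks_one]
    congr 1 <;> simp [hSA]

/-- Both Halmos dilations live on `a ⊕ a` and compress to its first summand, so a single isometry
serves A and B. Reindexing by `Fin n` matches the infimum in `effectiveOverlap`. -/
lemma exists_joint_involution {A B : Matrix a a ℂ} (hA : A.IsHermitian)
    (hAA : (1 - A * A).PosSemidef) (hB : B.IsHermitian) (hBB : (1 - B * B).PosSemidef) :
    ∃ (n : ℕ) (U : Matrix (Fin n) a ℂ) (A' B' : Matrix (Fin n) (Fin n) ℂ), Uᴴ * U = 1 ∧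
      A'.IsHermitian ∧ A' * A' = 1 ∧ Uᴴ * A' * U = A ∧
      B'.IsHermitian ∧ B' * B' = 1 ∧ Uᴴ * B' * U = B := by
  obtain ⟨A', hA', hAA', rfl⟩ := exists_involution_toBlocks₁₁_eq hA hAA
  obtain ⟨B', hB', hBB', rfl⟩ := exists_involution_toBlocks₁₁_eq hB hBB
  let e := (Fintype.equivFin (a ⊕ a)).symm
  have hsq : ∀ T : Matrix (a ⊕ a) (a ⊕ a) ℂ, T * T = 1 → T.submatrix e e * T.submatrix e e = 1 := by
    intro T hT
    rw [Matrix.submatrix_mul_equiv, hT, Matrix.submatrix_one_equiv]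
  have hcomp : ∀ T : Matrix (a ⊕ a) (a ⊕ a) ℂ,
      ((Matrix.fromRows (1 : Matrix a a ℂ) 0).submatrix e id)ᴴ * T.submatrix e e *
        (Matrix.fromRows (1 : Matrix a a ℂ) 0).submatrix e id = T.toBlocks₁₁ := by
    intro T
    rw [Matrix.conjTranspose_submatrix, Matrix.submatrix_mul_equiv, Matrix.submatrix_mul_equiv]
    ext i j
    simp [Matrix.mul_apply, Fintype.sum_sum_type, Matrix.one_apply, Matrix.toBlocks₁₁]
  refine ⟨_, (Matrix.fromRows (1 : Matrix a a ℂ) 0).submatrix e id, A'.submatrix e e,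
    B'.submatrix e e, ?_, hA'.submatrix e, hsq _ hAA', hcomp _, hB'.submatrix e, hsq _ hBB',
    hcomp _⟩
  have := hcomp 1
  rw [Matrix.submatrix_one_equiv, Matrix.mul_one] at this
  rw [this]
  ext i j
  simp [Matrix.toBlocks₁₁, Matrix.one_apply]

end Hermitian

/-! ### Binary measurements and their observables -/

section Binary

variable {a : Type*} [Fintype a] [DecidableEq a]

/-- The two-valued observable of a binary measurement. -/
def observable (M : Fin 2 → Matrix a a ℂ) : Matrix a a ℂ := M 0 - M 1

lemma IsMeasurement.add_eq_one {M : Fin 2 → Matrix a a ℂ} (hM : IsMeasurement M) :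
    M 0 + M 1 = 1 := by
  rw [← hM.sum_eq_one, Fin.sum_univ_two]

lemma IsMeasurement.isHermitian_observable {M : Fin 2 → Matrix a a ℂ} (hM : IsMeasurement M) :
    (observable M).IsHermitian :=
  (hM.posSemidef 0).1.sub (hM.posSemidef 1).1

lemma IsMeasurement.posSemidef_one_sub_observable {M : Fin 2 → Matrix a a ℂ}
    (hM : IsMeasurement M) : (1 - observable M * observable M).PosSemidef := by
  have h1 : M 1 = 1 - M 0 := eq_sub_of_add_eq' hM.add_eq_one
  have h0 := hM.posSemidef 0
  have h := ((hM.posSemidef 1).mul_mul_conjTranspose_same (M 0)).add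
    (h0.mul_mul_conjTranspose_same (M 1))
  rw [(hM.posSemidef 0).1.eq, (hM.posSemidef 1).1.eq] at h
  -- The observable is 2 M₀ - 1, so the left side is 4 M₀M₁; inserting M₀ + M₁ = 1 between commuting
  -- factors makes it visibly positive.
  have e : 1 - observable M * observable M
      = (4 : ℝ) • (M 0 * M 1 * M 0 + M 1 * M 0 * M 1) := by
    rw [observable, h1]
    simp only [mul_sub, sub_mul, mul_one, one_mul, mul_assoc]
    module
  rw [e]
  exact h.smul (by norm_num)

/-- The projectors onto the eigenspaces of an involution. -/
noncomputable def involutionMeasurement (A : Matrix a a ℂ) (x : Fin 2) : Matrix a a ℂ :=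
  (1 / 2 : ℝ) • (1 + (![1, -1] x : ℝ) • A)

/-- The formula (1 ± A)/2 is used here for an observable that need not be an involution; dilating
the observable therefore dilates the measurement. -/
lemma IsMeasurement.eq_involutionMeasurement {M : Fin 2 → Matrix a a ℂ} (hM : IsMeasurement M)
    (x : Fin 2) : M x = involutionMeasurement (observable M) x := by
  rw [involutionMeasurement, observable, ← hM.add_eq_one]
  fin_cases x <;> simp <;> module

lemma isMeasurement_involutionMeasurement {A : Matrix a a ℂ} (hA : A.IsHermitian)
    (hAA : A * A = 1) : IsMeasurement (involutionMeasurement A) := by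
  refine ⟨fun x => ?_, ?_⟩
  · have hH : (involutionMeasurement A x)ᴴ = involutionMeasurement A x := by
      simp [involutionMeasurement, hA.eq]
    have hsq : involutionMeasurement A x * involutionMeasurement A x
        = involutionMeasurement A x := by
      simp only [involutionMeasurement, smul_mul_assoc, mul_smul_comm, add_mul, mul_add, mul_one,
        one_mul, hAA]
      fin_cases x <;> simp <;> module
    have := Matrix.posSemidef_conjTranspose_mul_self (involutionMeasurement A x)
    rwa [hH, hsq] at this
  · rw [Fin.sum_univ_two]
    simp [involutionMeasurement]
    module

lemma conjTranspose_mul_involutionMeasurement_mul {b : Type*} [Fintype b] [DecidableEq b]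
    {c : Type*} [DecidableEq c] {U : Matrix b c ℂ} (hU : Uᴴ * U = 1) (A : Matrix b b ℂ) (x : Fin 2) :
    Uᴴ * involutionMeasurement A x * U = involutionMeasurement (Uᴴ * A * U) x := by
  simp only [involutionMeasurement, Matrix.mul_smul, Matrix.smul_mul, Matrix.mul_add,
    Matrix.add_mul, Matrix.mul_one, hU]

lemma Commute.involutionMeasurement_right {P A : Matrix a a ℂ} (h : Commute P A) (x : Fin 2) :
    Commute P (involutionMeasurement A x) :=
  ((Commute.one_right P).add_right (h.smul_right _)).smul_right _

/-- Averaging over N_y sends T to (T + BTB)/2, and A + BAB = B(AB + BA). -/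
lemma sum_involutionMeasurement_sandwich {A B K : Matrix a a ℂ} (hBB : B * B = 1)
    (hK : A * B + B * A = K) (x : Fin 2) :
    ∑ y, involutionMeasurement B y * involutionMeasurement A x * involutionMeasurement B y
      = (1 / 2 : ℝ) • (1 : Matrix a a ℂ) + ((![1, -1] x : ℝ) / 4) • (B * K) := by
  rw [Fin.sum_univ_two, ← hK]
  have h : B * (B * A) = A := by rw [← mul_assoc, hBB, one_mul]
  simp only [involutionMeasurement, smul_mul_assoc, mul_smul_comm, add_mul, mul_add, mul_one,
    one_mul, hBB, mul_assoc, h, Matrix.cons_val_zero, Matrix.cons_val_one]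
  module

end Binary

/-! ### Upper bound on the overlap from the anticommutator -/

section Upper

variable {a d : Type*} [Fintype a] [DecidableEq a] [Fintype d] [DecidableEq d]

/-- The CHSH value in terms of two-valued observables. -/
lemma chshValue_eq_expval {ρ : Matrix (a × d) (a × d) ℂ} (hρ : IsQState ρ)
    {X Y : Fin 2 → Matrix a a ℂ} (hX : IsMeasurement X) (hY : IsMeasurement Y)
    {R S : Fin 2 → Matrix d d ℂ} (hR : IsMeasurement R) (hS : IsMeasurement S) :
    chshValue ρ X Y R S =
      expval ρ ((observable X + observable Y) ⊗ₖ observable R) +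
      expval ρ ((observable X - observable Y) ⊗ₖ observable S) := by
  have hX1 : X 1 = 1 - X 0 := eq_sub_of_add_eq' hX.add_eq_one
  have hY1 : Y 1 = 1 - Y 0 := eq_sub_of_add_eq' hY.add_eq_one
  have hR1 : R 1 = 1 - R 0 := eq_sub_of_add_eq' hR.add_eq_one
  have hS1 : S 1 = 1 - S 0 := eq_sub_of_add_eq' hS.add_eq_one
  have h1 := hρ.expval_one
  have key : (2 : ℝ) • (∑ i, (X i ⊗ₖ (R i + S i) + Y i ⊗ₖ (R i + S (1 - i))))
      = (observable X + observable Y) ⊗ₖ observable R +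
        (observable X - observable Y) ⊗ₖ observable S + (4 : ℝ) • 1 := by
    rw [Fin.sum_univ_two, ← Matrix.one_kronecker_one]
    simp only [observable, hX1, hY1, hR1, hS1, sub_self, sub_zero]
    ext ⟨i, j⟩ ⟨k, l⟩
    simp only [Matrix.smul_apply, Matrix.add_apply, Matrix.sub_apply, Matrix.kroneckerMap_apply,
      Complex.real_smul]
    push_cast
    ring
  have := congrArg (expval ρ) key
  rw [map_smul, map_add, map_add, map_smul, h1] at this
  simp only [smul_eq_mul] at this
  rw [chshValue, ← expval_apply]
  linarith

/-- On the block the anticommutator is μ, so the sum is P/2 ± (μ/4) BP, and both P and BP have norm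
at most 1. -/
lemma qOpNorm_block_le {P A B K : Matrix a a ℂ} {μ : ℝ} (hP : P.IsHermitian) (hPP : P * P = P)
    (hPA : Commute P A) (hPB : Commute P B) (hB : B.IsHermitian) (hBB : B * B = 1)
    (hK : A * B + B * A = K) (hKP : K * P = μ • P) (x : Fin 2) :
    qOpNorm (∑ y, (P * involutionMeasurement B y * P) * (P * involutionMeasurement A x * P) *
      (P * involutionMeasurement B y * P)) ≤ 1 / 2 + |μ| / 4 := by
  have hblock : ∀ T, Commute P T → P * T * P = T * P := fun T hT => by
    rw [hT.eq, mul_assoc, hPP]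
  have hprod : ∀ S T, Commute P S → Commute P T →
      (P * S * P) * (P * T * P) * (P * S * P) = S * T * S * P := fun S T hS hT => by
    rw [hblock S hS, hblock T hT, mul_assoc S P, ← mul_assoc P T, hT.eq, mul_assoc T P P, hPP,
      ← mul_assoc S, mul_assoc (S * T), ← mul_assoc P, hS.eq, mul_assoc S P P, hPP, ← mul_assoc]
  have hsum : ∑ y, (P * involutionMeasurement B y * P) * (P * involutionMeasurement A x * P) *
      (P * involutionMeasurement B y * P)
      = (1 / 2 : ℝ) • P + ((![1, -1] x : ℝ) / 4 * μ) • (B * P) := by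
    rw [Finset.sum_congr rfl fun y _ => hprod _ _ (hPB.involutionMeasurement_right y)
      (hPA.involutionMeasurement_right x), ← Finset.sum_mul,
      sum_involutionMeasurement_sandwich hBB hK, add_mul, smul_mul_assoc, smul_mul_assoc, one_mul,
      mul_assoc, hKP, mul_smul_comm, smul_smul]
  have h1 : qOpNorm P ≤ 1 :=
    qOpNorm_le_one_of_conjTranspose_mul_self_idem hP hPP (by rw [hP.eq, hPP])
  have h2 : qOpNorm (B * P) ≤ 1 := by
    refine qOpNorm_le_one_of_conjTranspose_mul_self_idem hP hPP ?_
    rw [Matrix.conjTranspose_mul, hB.eq, hP.eq, mul_assoc, ← mul_assoc B, hBB, one_mul, hPP]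
  have hx : |(![1, -1] x : ℝ) / 4| = 1 / 4 := by fin_cases x <;> norm_num [abs_of_pos]
  rw [hsum]
  refine (qOpNorm_add_le _ _).trans ?_
  rw [qOpNorm_real_smul, qOpNorm_real_smul, abs_mul, hx, abs_of_pos one_half_pos]
  nlinarith [abs_nonneg μ, qOpNorm_nonneg P, qOpNorm_nonneg (B * P)]

lemma IsProjMeasurement.isHermitian {σ : Type*} [Fintype σ] {P : σ → Matrix a a ℂ}
    (hP : IsProjMeasurement P) (k : σ) : (P k).IsHermitian :=
  (hP.isMeasurement.posSemidef k).1

lemma slicedOverlap_nonneg {ι κ σ : Type*} [Fintype κ] [Fintype σ] {ρ : Matrix a a ℂ}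
    (hρ : ρ.PosSemidef) (M : ι → Matrix a a ℂ) (N : κ → Matrix a a ℂ) {P : σ → Matrix a a ℂ}
    (hP : IsMeasurement P) : 0 ≤ slicedOverlap ρ M N P :=
  Finset.sum_nonneg fun k _ => mul_nonneg (expval_nonneg hρ (hP.posSemidef k))
    (Real.iSup_nonneg fun _ => qOpNorm_nonneg _)

lemma bddBelow_slicedOverlap {ι κ : Type*} [Fintype ι] [Fintype κ] {ρ : Matrix a a ℂ}
    (hρ : ρ.PosSemidef) (M : ι → Matrix a a ℂ) (N : κ → Matrix a a ℂ) :
    0 ∈ lowerBounds {c : ℝ | ∃ (n s : ℕ) (U : Matrix (Fin n) a ℂ)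
      (M' : ι → Matrix (Fin n) (Fin n) ℂ) (N' : κ → Matrix (Fin n) (Fin n) ℂ)
      (P : Fin s → Matrix (Fin n) (Fin n) ℂ),
      IsJointDilation M N U M' N' P ∧ c = slicedOverlap (U * ρ * Uᴴ) M' N' P} := by
  rintro c ⟨n, s, U, M', N', P, h, rfl⟩
  exact slicedOverlap_nonneg (hρ.mul_mul_conjTranspose_same U) _ _ h.proj.isMeasurement

lemma effectiveOverlap_nonneg {ι κ : Type*} [Fintype ι] [Fintype κ] {ρ : Matrix a a ℂ}
    (hρ : ρ.PosSemidef) (M : ι → Matrix a a ℂ) (N : κ → Matrix a a ℂ) :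
    0 ≤ effectiveOverlap ρ M N :=
  Real.sInf_nonneg fun _ hc => bddBelow_slicedOverlap hρ M N hc

/-- The Cauchy-Schwarz bound on the CHSH value, block by block, for an anticommutator that is
scalar on each block. -/
lemma expval_chsh_le_of_blocks {σ : Type*} [Fintype σ] {ρ : Matrix (a × d) (a × d) ℂ}
    (hρ : ρ.PosSemidef) {A B K : Matrix a a ℂ} {P : σ → Matrix a a ℂ} {μ : σ → ℝ}
    {C D : Matrix d d ℂ} (hA : A.IsHermitian) (hAA : A * A = 1) (hB : B.IsHermitian)
    (hBB : B * B = 1) (hK : A * B + B * A = K) (hP : IsProjMeasurement P)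
    (hKP : ∀ k, K * P k = μ k • P k) (hPA : ∀ k, Commute (P k) A) (hPB : ∀ k, Commute (P k) B)
    (hC : C.IsHermitian) (hCC : (1 - C * C).PosSemidef)
    (hD : D.IsHermitian) (hDD : (1 - D * D).PosSemidef) {t : ℝ}
    (hone : ∑ k, expval ρ (P k ⊗ₖ (1 : Matrix d d ℂ)) = 1)
    (ht : ∑ k, expval ρ (P k ⊗ₖ (1 : Matrix d d ℂ)) * |μ k| = t) :
    t ≤ 2 ∧ expval ρ ((A + B) ⊗ₖ C) + expval ρ ((A - B) ⊗ₖ D) ≤ √(2 + t) + √(2 - t) := by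
  let p : σ → ℝ := fun k => expval ρ (P k ⊗ₖ (1 : Matrix d d ℂ))
  change ∑ k, p k = 1 at hone
  change ∑ k, p k * |μ k| = t at ht
  have hherm : ∀ (T : Matrix a a ℂ) (k : σ), T.IsHermitian → Commute (P k) T →
      (T * P k).IsHermitian := fun T k hT hc => by
    rw [Matrix.IsHermitian, Matrix.conjTranspose_mul, hT.eq, (hP.isHermitian k).eq, hc.eq]
  -- To be used with T = A ± B and ν = 2 ± μ. Only ν * p k is shown nonnegative, since P k = 0 is
  -- not excluded.
  have hblock : ∀ (T : Matrix a a ℂ) (E : Matrix d d ℂ) (ν : ℝ) (k : σ), T.IsHermitian →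
      Commute (P k) T → E.IsHermitian → (1 - E * E).PosSemidef →
      T * T * P k = ν • P k →
      0 ≤ ν * p k ∧ expval ρ ((T * P k) ⊗ₖ E) ≤ √(p k) * √(ν * p k) := by
    intro T E ν k hT hc hE hEE hν
    have hsq : (T * P k) * (T * P k) = ν • P k := by
      rw [mul_assoc, ← mul_assoc (P k), hc.eq, mul_assoc T (P k), hP.idem, ← mul_assoc, hν]
    have hval : expval ρ ((ν • P k) ⊗ₖ (1 : Matrix d d ℂ)) = ν * p k := by
      rw [Matrix.smul_kronecker, map_smul, smul_eq_mul]
    have h0 : 0 ≤ ν * p k := by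
      rw [← hval, ← hsq]
      have h2 := expval_mul_self_nonneg (Z := (T * P k) ⊗ₖ (1 : Matrix d d ℂ)) hρ (by
        rw [Matrix.IsHermitian, Matrix.conjTranspose_kronecker, (hherm T k hT hc).eq,
          Matrix.conjTranspose_one])
      rwa [← Matrix.mul_kronecker_mul, one_mul] at h2
    refine ⟨h0, ?_⟩
    have h := expval_kronecker_le_sqrt hρ (hherm T k hT hc) (hP.isHermitian k) (hP.idem k)
      (by rw [← mul_assoc, hc.eq, mul_assoc, hP.idem]) (by rw [mul_assoc, hP.idem]) hE hEE
    rw [hsq, hval, Real.sqrt_mul h0] at h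
    linarith
  have hp0 : ∀ k, 0 ≤ p k := fun k =>
    expval_nonneg hρ ((hP.isMeasurement.posSemidef k).kronecker Matrix.PosSemidef.one)
  have hdecomp : ∀ (T : Matrix a a ℂ) (E : Matrix d d ℂ),
      expval ρ (T ⊗ₖ E) = ∑ k, expval ρ ((T * P k) ⊗ₖ E) := by
    intro T E
    rw [← map_sum]
    congr 1
    conv_lhs => rw [← mul_one T, ← hP.isMeasurement.sum_eq_one, Finset.mul_sum]
    ext ⟨i, j⟩ ⟨k, l⟩
    simp [Matrix.sum_apply, Finset.sum_mul]
  have hplus : ∀ k, (A + B) * (A + B) * P k = (2 + μ k) • P k := fun k => by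
    have : (A + B) * (A + B) = (2 : ℝ) • 1 + K := by
      rw [← hK]
      simp only [add_mul, mul_add, hAA, hBB]
      module
    rw [this, add_mul, hKP, smul_mul_assoc, one_mul, add_smul]
  have hminus : ∀ k, (A - B) * (A - B) * P k = (2 - μ k) • P k := fun k => by
    have : (A - B) * (A - B) = (2 : ℝ) • 1 - K := by
      rw [← hK]
      simp only [sub_mul, mul_sub, hAA, hBB]
      module
    rw [this, sub_mul, hKP, smul_mul_assoc, one_mul, sub_smul]
  have h1 := fun k => hblock (A + B) C _ k (hA.add hB) ((hPA k).add_right (hPB k)) hC hCC (hplus k)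
  have h2 := fun k => hblock (A - B) D _ k (hA.sub hB) ((hPA k).sub_right (hPB k)) hD hDD
    (hminus k)
  have hq1 : ∀ k, 0 ≤ (2 + |μ k|) * p k := fun k =>
    mul_nonneg (by positivity) (hp0 k)
  have hq2 : ∀ k, 0 ≤ (2 - |μ k|) * p k := fun k => by
    rcases abs_cases (μ k) with h | h
    · rw [h.1]; exact (h2 k).1
    · rw [h.1, sub_neg_eq_add]; exact (h1 k).1
  have hsum1 : ∑ k, (2 + |μ k|) * p k = 2 + t := by
    rw [← ht]
    simp only [add_mul, Finset.sum_add_distrib, ← Finset.mul_sum, hone, mul_one]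
    simp only [mul_comm]
  have hsum2 : ∑ k, (2 - |μ k|) * p k = 2 - t := by
    rw [← ht]
    simp only [sub_mul, Finset.sum_sub_distrib, ← Finset.mul_sum, hone, mul_one]
    simp only [mul_comm]
  refine ⟨by linarith [Finset.sum_nonneg fun k (_ : k ∈ Finset.univ) => hq2 k], ?_⟩
  -- The second Cauchy-Schwarz, over the blocks, uses ∑ p k = 1.
  have c1 := Real.sum_sqrt_mul_sqrt_le Finset.univ (f := p) (g := fun k => (2 + |μ k|) * p k)
    hp0 hq1
  have c2 := Real.sum_sqrt_mul_sqrt_le Finset.univ (f := p) (g := fun k => (2 - |μ k|) * p k)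
    hp0 hq2
  rw [hone, hsum1, Real.sqrt_one, one_mul] at c1
  rw [hone, hsum2, Real.sqrt_one, one_mul] at c2
  refine le_trans ?_ (add_le_add c1 c2)
  rw [hdecomp (A + B), hdecomp (A - B), ← Finset.sum_add_distrib, ← Finset.sum_add_distrib]
  refine Finset.sum_le_sum fun k _ => (add_le_add (h1 k).2 (h2 k).2).trans_eq ?_
  -- A negative μ k merely exchanges the two square roots.
  rcases abs_cases (μ k) with h | h
  · rw [h.1]
  · rw [h.1, sub_neg_eq_add, ← sub_eq_add_neg, add_comm]

/-- A measured bipartite state yields a joint dilation whose overlap is small when the CHSH value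
is large. -/
lemma exists_effectiveOverlap_le {ρA : Matrix a a ℂ} (hρA : IsQState ρA)
    {X Y : Fin 2 → Matrix a a ℂ} (hX : IsMeasurement X) (hY : IsMeasurement Y)
    {ρ : Matrix (a × d) (a × d) ℂ} (hρ : IsQState ρ) (hext : partialTraceRight ρ = ρA)
    {R S : Fin 2 → Matrix d d ℂ} (hR : IsMeasurement R) (hS : IsMeasurement S) :
    ∃ t : ℝ, 0 ≤ t ∧ t ≤ 2 ∧ effectiveOverlap ρA X Y ≤ 1 / 2 + t / 4 ∧
      chshValue ρ X Y R S ≤ √(2 + t) + √(2 - t) := by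
  obtain ⟨n, U, A, B, hU, hA, hAA, hUA, hB, hBB, hUB⟩ := exists_joint_involution
    hX.isHermitian_observable hX.posSemidef_one_sub_observable
    hY.isHermitian_observable hY.posSemidef_one_sub_observable
  have hKH : (A * B + B * A).IsHermitian := by
    rw [Matrix.IsHermitian, Matrix.conjTranspose_add, Matrix.conjTranspose_mul,
      Matrix.conjTranspose_mul, hA.eq, hB.eq, add_comm]
  obtain ⟨s, P, μ, hP, hKP, hcomm⟩ := hKH.exists_spectral_projections
  -- With A² = 1, both products of the anticommutator with A equal ABA + B.
  have hPA : ∀ k, Commute (P k) A := hcomm A (by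
    rw [commute_iff_eq, add_mul, mul_add, mul_assoc B A A, hAA, ← mul_assoc A A B, hAA, mul_one,
      one_mul, mul_assoc, add_comm])
  have hPB : ∀ k, Commute (P k) B := hcomm B (by
    rw [commute_iff_eq, add_mul, mul_add, mul_assoc A B B, hBB, ← mul_assoc B B A, hBB, mul_one,
      one_mul, mul_assoc, add_comm])
  have hM := isMeasurement_involutionMeasurement hA hAA
  have hN := isMeasurement_involutionMeasurement hB hBB
  have hcompress : ∀ T : Matrix (Fin n) (Fin n) ℂ, (∀ k, Commute (P k) T) →
      ∑ k, Uᴴ * P k * T * P k * U = Uᴴ * T * U := fun T hT => by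
    have : ∀ k, Uᴴ * P k * T * P k * U = Uᴴ * T * P k * U := fun k => by
      rw [Matrix.mul_assoc Uᴴ, (hT k).eq, Matrix.mul_assoc Uᴴ, Matrix.mul_assoc T, hP.idem,
        Matrix.mul_assoc Uᴴ T]
    simp only [this]
    rw [← Matrix.sum_mul, ← Matrix.mul_sum, hP.isMeasurement.sum_eq_one, Matrix.mul_one]
  have hdil : IsJointDilation X Y U (involutionMeasurement A) (involutionMeasurement B) P := by
    refine ⟨hU, hM, hN, hP, fun x => ?_, fun y => ?_⟩
    · rw [hcompress _ fun k => (hPA k).involutionMeasurement_right x,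
        conjTranspose_mul_involutionMeasurement_mul hU, hUA, ← hX.eq_involutionMeasurement]
    · rw [hcompress _ fun k => (hPB k).involutionMeasurement_right y,
        conjTranspose_mul_involutionMeasurement_mul hU, hUB, ← hY.eq_involutionMeasurement]
  let V : Matrix (Fin n × d) (a × d) ℂ := U ⊗ₖ (1 : Matrix d d ℂ)
  have hρ' : (V * ρ * Vᴴ).PosSemidef := hρ.posSemidef.mul_mul_conjTranspose_same V
  have hlift : ∀ (T : Matrix (Fin n) (Fin n) ℂ) (E : Matrix d d ℂ),
      expval (V * ρ * Vᴴ) (T ⊗ₖ E) = expval ρ ((Uᴴ * T * U) ⊗ₖ E) := fun T E => by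
    rw [← expval_conj, Matrix.conjTranspose_kronecker, ← Matrix.mul_kronecker_mul,
      ← Matrix.mul_kronecker_mul, Matrix.conjTranspose_one, Matrix.one_mul, Matrix.mul_one]
  have hlocal : ∀ T : Matrix (Fin n) (Fin n) ℂ,
      expval (V * ρ * Vᴴ) (T ⊗ₖ 1) = expval (U * ρA * Uᴴ) T := fun T => by
    rw [hlift, expval_kronecker_one, hext, expval_conj]
  have hone : ∑ k, expval (V * ρ * Vᴴ) (P k ⊗ₖ (1 : Matrix d d ℂ)) = 1 := by
    simp only [hlocal]
    rw [← map_sum, hP.isMeasurement.sum_eq_one, ← expval_conj, Matrix.mul_one, hU,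
      hρA.expval_one]
  have hbound := expval_chsh_le_of_blocks hρ' hA hAA hB hBB rfl hP hKP hPA hPB
    hR.isHermitian_observable hR.posSemidef_one_sub_observable
    hS.isHermitian_observable hS.posSemidef_one_sub_observable hone rfl
  simp only [hlocal] at hone hbound
  have hp0 : ∀ k, 0 ≤ expval (U * ρA * Uᴴ) (P k) := fun k =>
    expval_nonneg (hρA.posSemidef.mul_mul_conjTranspose_same U) (hP.isMeasurement.posSemidef k)
  refine ⟨_, Finset.sum_nonneg fun k _ => mul_nonneg (hp0 k) (abs_nonneg (μ k)), hbound.1, ?_, ?_⟩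
  · calc effectiveOverlap ρA X Y
        ≤ slicedOverlap (U * ρA * Uᴴ) (involutionMeasurement A) (involutionMeasurement B) P :=
          csInf_le ⟨0, bddBelow_slicedOverlap hρA.posSemidef X Y⟩
            ⟨n, s, U, _, _, P, hdil, rfl⟩
      _ ≤ ∑ k, expval (U * ρA * Uᴴ) (P k) * (1 / 2 + |μ k| / 4) :=
          Finset.sum_le_sum fun k _ => mul_le_mul_of_nonneg_left (ciSup_le fun x =>
            qOpNorm_block_le (hP.isHermitian k) (hP.idem k) (hPA k) (hPB k) hB hBB rfl (hKP k) x)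
            (hp0 k)
      _ = _ := by
          simp only [mul_add, Finset.sum_add_distrib, ← Finset.sum_mul, hone, one_mul,
            Finset.sum_div, mul_div_assoc]
  · rw [chshValue_eq_expval hρ hX hY hR hS]
    rw [hlift, hlift, Matrix.mul_add, Matrix.mul_sub, Matrix.add_mul, Matrix.sub_mul, hUA,
      hUB] at hbound
    exact hbound.2

end Upper

/-! ### Lower bound on the overlap of every dilation -/

section Lower

variable {a d : Type*} [Fintype a] [DecidableEq a] [Fintype d] [DecidableEq d]

/-- The local bound on the CHSH value by the second observable alone. -/
lemma chshValue_le_two_mul_sqrt {ρA : Matrix a a ℂ} (hρA : IsQState ρA)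
    {X Y : Fin 2 → Matrix a a ℂ} (hX : IsMeasurement X) (hY : IsMeasurement Y)
    {ρ : Matrix (a × d) (a × d) ℂ} (hρ : IsQState ρ) (hext : partialTraceRight ρ = ρA)
    {R S : Fin 2 → Matrix d d ℂ} (hR : IsMeasurement R) (hS : IsMeasurement S) :
    chshValue ρ X Y R S ≤ 2 * √(1 + expval ρA (observable Y * observable Y)) := by
  have hA := hX.isHermitian_observable
  have hB := hY.isHermitian_observable
  have hAA := expval_nonneg hρA.posSemidef hX.posSemidef_one_sub_observable
  rw [map_sub, hρA.expval_one] at hAA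
  rw [chshValue_eq_expval hρ hX hY hR hS]
  set A := observable X
  set B := observable Y
  have h1 := expval_kronecker_sq_le hρ.posSemidef (hA.add hB) Matrix.isHermitian_one (one_mul 1)
    (one_mul _) (mul_one _) hR.isHermitian_observable hR.posSemidef_one_sub_observable
  have h2 := expval_kronecker_sq_le hρ.posSemidef (hA.sub hB) Matrix.isHermitian_one (one_mul 1)
    (one_mul _) (mul_one _) hS.isHermitian_observable hS.posSemidef_one_sub_observable
  rw [expval_kronecker_one, expval_kronecker_one, hext, hρA.expval_one, mul_one] at h1 h2
  have e : (A + B) * (A + B) + (A - B) * (A - B) = (2 : ℝ) • (A * A + B * B) := by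
    simp only [add_mul, mul_add, sub_mul, mul_sub]
    module
  have e' := congrArg (expval ρA) e
  rw [map_add, map_smul, map_add, smul_eq_mul] at e'
  set q := expval ρ ((A + B) ⊗ₖ observable R)
  set r := expval ρ ((A - B) ⊗ₖ observable S)
  have h4 : (2 : ℝ) = √4 := by
    rw [show (4 : ℝ) = 2 ^ 2 by norm_num, Real.sqrt_sq zero_le_two]
  rw [h4, ← Real.sqrt_mul (by norm_num)]
  refine Real.le_sqrt_of_sq_le ?_
  -- (q + r)² ≤ 2(q² + r²) ≤ 4(⟨A²⟩ + ⟨B²⟩), and ⟨A²⟩ ≤ 1.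
  nlinarith [sq_nonneg (q - r)]

omit [Fintype d] in
/-- The Kadison inequality for the square of a compressed family of Hermitian matrices. -/
lemma posSemidef_sum_conj_sq_sub {σ b : Type*} [Fintype σ] [Fintype b] {V : σ → Matrix b a ℂ}
    {T : σ → Matrix b b ℂ} {B : Matrix a a ℂ} (hT : ∀ k, (T k).IsHermitian)
    (hB : B.IsHermitian) (hV : ∑ k, (V k)ᴴ * V k = 1) (hTB : ∑ k, (V k)ᴴ * T k * V k = B) :
    (∑ k, (V k)ᴴ * (T k * T k) * V k - B * B).PosSemidef := by
  -- The difference is the sum of |T_k V_k - V_k B|².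
  have h := Matrix.posSemidef_sum Finset.univ fun k (_ : k ∈ Finset.univ) =>
    Matrix.posSemidef_conjTranspose_mul_self (T k * V k - V k * B)
  convert h using 1
  have e : ∀ k, (T k * V k - V k * B)ᴴ * (T k * V k - V k * B)
      = (V k)ᴴ * (T k * T k) * V k - ((V k)ᴴ * T k * V k) * B - B * ((V k)ᴴ * T k * V k)
        + B * ((V k)ᴴ * V k) * B := fun k => by
    rw [Matrix.conjTranspose_sub, Matrix.conjTranspose_mul, Matrix.conjTranspose_mul, hB.eq,
      (hT k).eq]
    simp only [Matrix.mul_sub, Matrix.sub_mul, Matrix.mul_assoc]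
    abel
  simp only [e, Finset.sum_add_distrib, Finset.sum_sub_distrib, ← Finset.sum_mul,
    ← Finset.mul_sum, hV, hTB, mul_one]
  abel

/-- Summing over x removes M. What remains is 2(n₀² + n₁²) = (n₀ + n₁)² + (n₀ - n₁)² with n_y = P
N_y P and n₀ + n₁ = P. -/
lemma sum_sandwich_eq {P : Matrix a a ℂ} (hPP : P * P = P) {M N : Fin 2 → Matrix a a ℂ}
    (hM : IsMeasurement M) (hN : IsMeasurement N) :
    (2 : ℝ) • ∑ x, ∑ y, (P * N y * P) * (P * M x * P) * (P * N y * P)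
      = P + (P * observable N * P) * (P * observable N * P) := by
  have hMP : P * M 0 * P + P * M 1 * P = P := by
    rw [← add_mul, ← mul_add, hM.add_eq_one, mul_one, hPP]
  have hNP : P * N 1 * P = P - P * N 0 * P := by
    rw [eq_sub_iff_add_eq', ← add_mul, ← mul_add, hN.add_eq_one, mul_one, hPP]
  have hPN : P * (P * N 0 * P) = P * N 0 * P := by simp only [← mul_assoc, hPP]
  have hNP' : (P * N 0 * P) * P = P * N 0 * P := by rw [mul_assoc, hPP]
  rw [Finset.sum_comm]
  simp only [Fin.sum_univ_two, ← add_mul, ← mul_add, hMP, hNP, observable, mul_sub, sub_mul]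
  generalize P * N 0 * P = T at *
  simp only [hPN, hNP', hPP]
  module

/-- No commutation of P with M or N is available, so Kadison's inequality compares the block squares
with the square of the original observable. The 4 combines the 2 in `sum_sandwich_eq` with the two
outcomes x, each bounded by the maximum. -/
lemma expval_observable_sq_le_slicedOverlap {σ b : Type*} [Fintype σ] [Fintype b] [DecidableEq b]
    {ρ : Matrix a a ℂ} (hρ : IsQState ρ) {X Y : Fin 2 → Matrix a a ℂ} (hY : IsMeasurement Y)
    {U : Matrix b a ℂ} {M N : Fin 2 → Matrix b b ℂ} {P : σ → Matrix b b ℂ}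
    (h : IsJointDilation X Y U M N P) :
    1 + expval ρ (observable Y * observable Y) ≤ 4 * slicedOverlap (U * ρ * Uᴴ) M N P := by
  have hρ' : (U * ρ * Uᴴ).PosSemidef := hρ.posSemidef.mul_mul_conjTranspose_same U
  have hPh := h.proj.isHermitian
  have hPP := h.proj.idem
  have hVV : ∀ k, (P k * U)ᴴ * (P k * U) = Uᴴ * P k * U := fun k => by
    rw [Matrix.conjTranspose_mul, (hPh k).eq, Matrix.mul_assoc, ← Matrix.mul_assoc (P k), hPP,
      Matrix.mul_assoc]
  have hV : ∑ k, (P k * U)ᴴ * (P k * U) = 1 := by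
    simp only [hVV]
    rw [← Matrix.sum_mul, ← Matrix.mul_sum, h.proj.isMeasurement.sum_eq_one, Matrix.mul_one,
      h.isometry]
  have hherm : ∀ S T : Matrix b b ℂ, S.IsHermitian → T.IsHermitian → (S * T * S).IsHermitian :=
    fun S T hS hT => by
      rw [Matrix.IsHermitian, Matrix.conjTranspose_mul, Matrix.conjTranspose_mul, hT.eq, hS.eq,
        mul_assoc]
  have hsand : ∀ (k) (T : Matrix b b ℂ), T.IsHermitian → (P k * T * P k).IsHermitian :=
    fun k T hT => hherm _ _ (hPh k) hT
  have hconj : ∀ k (T : Matrix b b ℂ), (P k * U)ᴴ * (P k * T * P k) * (P k * U)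
      = Uᴴ * (P k * T * P k) * U := fun k T => by
    rw [Matrix.conjTranspose_mul, (hPh k).eq]
    simp only [← Matrix.mul_assoc]
    rw [Matrix.mul_assoc Uᴴ (P k) (P k), hPP, Matrix.mul_assoc _ (P k) (P k), hPP]
  have hB : ∑ k, (P k * U)ᴴ * (P k * observable N * P k) * (P k * U) = observable Y := by
    simp only [hconj]
    rw [observable, observable, ← h.right_eq 0, ← h.right_eq 1, ← Finset.sum_sub_distrib]
    refine Finset.sum_congr rfl fun k _ => ?_
    simp only [Matrix.mul_sub, Matrix.sub_mul, Matrix.mul_assoc]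
  have hkad := expval_mono hρ.posSemidef (posSemidef_sum_conj_sq_sub
    (fun k => hsand k _ h.right.isHermitian_observable) hY.isHermitian_observable hV hB)
  have hone : ∑ k, expval (U * ρ * Uᴴ) (P k) = 1 := by
    rw [← map_sum, h.proj.isMeasurement.sum_eq_one, ← expval_conj, Matrix.mul_one, h.isometry,
      hρ.expval_one]
  have hsq : ∀ k, expval ρ ((P k * U)ᴴ * ((P k * observable N * P k) * (P k * observable N * P k))
      * (P k * U)) = expval (U * ρ * Uᴴ)
        ((P k * observable N * P k) * (P k * observable N * P k)) := fun k => by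
    have e : (P k * observable N * P k) * (P k * observable N * P k)
        = P k * (observable N * P k * (P k * observable N)) * P k := by simp only [mul_assoc]
    rw [← expval_conj, e, hconj]
  rw [map_sum] at hkad
  simp only [hsq] at hkad
  calc 1 + expval ρ (observable Y * observable Y)
      ≤ ∑ k, expval (U * ρ * Uᴴ)
          (P k + (P k * observable N * P k) * (P k * observable N * P k)) := by
        simp only [map_add, Finset.sum_add_distrib, hone]
        linarith
    _ ≤ ∑ k, 4 * ((P k * (U * ρ * Uᴴ)).trace.re * ⨆ x, qOpNorm
          (∑ y, (P k * N y * P k) * (P k * M x * P k) * (P k * N y * P k))) := by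
        refine Finset.sum_le_sum fun k _ => ?_
        rw [← sum_sandwich_eq (hPP k) h.left h.right, map_smul, smul_eq_mul, map_sum,
          Fin.sum_univ_two]
        have hle : ∀ x, expval (U * ρ * Uᴴ)
            (∑ y, (P k * N y * P k) * (P k * M x * P k) * (P k * N y * P k))
            ≤ expval (U * ρ * Uᴴ) (P k) * ⨆ x, qOpNorm
              (∑ y, (P k * N y * P k) * (P k * M x * P k) * (P k * N y * P k)) := by
          intro x
          set T := ∑ y, (P k * N y * P k) * (P k * M x * P k) * (P k * N y * P k) with hT
          have hTH : T.IsHermitian := by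
            rw [Matrix.IsHermitian, hT, Matrix.conjTranspose_sum]
            refine Finset.sum_congr rfl fun y _ => ?_
            exact hherm _ _ (hsand k _ (h.right.posSemidef y).1)
              (hsand k _ (h.left.posSemidef x).1)
          have hPT : P k * T * P k = T := by
            rw [hT, Finset.mul_sum, Finset.sum_mul]
            refine Finset.sum_congr rfl fun y _ => ?_
            simp only [← mul_assoc, hPP]
            rw [mul_assoc _ (P k) (P k), hPP]
          -- T is supported on the block, so compressing the state there preserves its expectation
          -- and reduces the trace to the block's weight.
          have hρk := hρ'.mul_mul_conjTranspose_same (P k)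
          have hle := expval_le_qOpNorm_mul hρk hTH
          have e1 : expval (P k * (U * ρ * Uᴴ) * (P k)ᴴ) T = expval (U * ρ * Uᴴ) T := by
            rw [← expval_conj, (hPh k).eq, hPT]
          have e2 : expval (P k * (U * ρ * Uᴴ) * (P k)ᴴ) 1 = expval (U * ρ * Uᴴ) (P k) := by
            rw [← expval_conj, (hPh k).eq, mul_one, hPP]
          rw [e1, e2, mul_comm] at hle
          exact hle.trans (mul_le_mul_of_nonneg_left
            (le_ciSup (f := fun x => qOpNorm
              (∑ y, (P k * N y * P k) * (P k * M x * P k) * (P k * N y * P k)))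
              (Set.finite_range _).bddAbove x)
            (expval_nonneg hρ' (h.proj.isMeasurement.posSemidef k)))
        have h0 := hle 0
        have h1 := hle 1
        rw [expval_apply _ (P k)] at h0 h1
        linarith
    _ = _ := by rw [slicedOverlap, Finset.mul_sum]

/-- Needed because the real infimum of the empty set defaults to 0; the trivial slicing P = 1
suffices. -/
lemma nonempty_slicedOverlap {ρ : Matrix a a ℂ} {X Y : Fin 2 → Matrix a a ℂ}
    (hX : IsMeasurement X) (hY : IsMeasurement Y) :
    {c : ℝ | ∃ (n s : ℕ) (U : Matrix (Fin n) a ℂ)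
      (M' : Fin 2 → Matrix (Fin n) (Fin n) ℂ) (N' : Fin 2 → Matrix (Fin n) (Fin n) ℂ)
      (P : Fin s → Matrix (Fin n) (Fin n) ℂ),
      IsJointDilation X Y U M' N' P ∧ c = slicedOverlap (U * ρ * Uᴴ) M' N' P}.Nonempty := by
  obtain ⟨n, U, A, B, hU, hA, hAA, hUA, hB, hBB, hUB⟩ := exists_joint_involution
    hX.isHermitian_observable hX.posSemidef_one_sub_observable
    hY.isHermitian_observable hY.posSemidef_one_sub_observable
  refine ⟨_, n, 1, U, involutionMeasurement A, involutionMeasurement B, fun _ => 1,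
    ⟨hU, isMeasurement_involutionMeasurement hA hAA, isMeasurement_involutionMeasurement hB hBB,
      ⟨⟨fun _ => Matrix.PosSemidef.one, by simp⟩, by simp⟩, fun x => ?_, fun y => ?_⟩, rfl⟩
  · simp [conjTranspose_mul_involutionMeasurement_mul hU, hUA, ← hX.eq_involutionMeasurement]
  · simp [conjTranspose_mul_involutionMeasurement_mul hU, hUB, ← hY.eq_involutionMeasurement]

lemma chshValue_le_four_mul_sqrt_effectiveOverlap {ρA : Matrix a a ℂ} (hρA : IsQState ρA)
    {X Y : Fin 2 → Matrix a a ℂ} (hX : IsMeasurement X) (hY : IsMeasurement Y)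
    {ρ : Matrix (a × d) (a × d) ℂ} (hρ : IsQState ρ) (hext : partialTraceRight ρ = ρA)
    {R S : Fin 2 → Matrix d d ℂ} (hR : IsMeasurement R) (hS : IsMeasurement S) :
    chshValue ρ X Y R S ≤ 4 * √(effectiveOverlap ρA X Y) := by
  have h : (1 + expval ρA (observable Y * observable Y)) / 4 ≤ effectiveOverlap ρA X Y := by
    refine le_csInf (nonempty_slicedOverlap hX hY) ?_
    rintro c ⟨n, s, U, M, N, P, hdil, rfl⟩
    linarith [expval_observable_sq_le_slicedOverlap hρA hY hdil]
  refine (chshValue_le_two_mul_sqrt hρA hX hY hρ hext hR hS).trans ?_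
  have h2 := Real.sqrt_le_sqrt h
  rw [Real.sqrt_div' _ (by norm_num), show (4 : ℝ) = 2 ^ 2 by norm_num,
    Real.sqrt_sq zero_le_two] at h2
  linarith

end Lower

/-! ### Elementary inequalities and conclusion -/

/-- The function `c ↦ √c + √(1 - c)` is antitone on `[1/2, 1]`. -/
lemma sqrt_add_sqrt_le_of_half_le {c t : ℝ} (h : 1 / 2 ≤ c) (hct : c ≤ 1 / 2 + t / 4)
    (ht : t ≤ 2) : √(2 + t) + √(2 - t) ≤ 2 * (√c + √(1 - c)) := by
  have e1 := Real.sq_sqrt (show 0 ≤ 2 + t by linarith)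
  have e2 := Real.sq_sqrt (show 0 ≤ 2 - t by linarith)
  have e3 := Real.sq_sqrt (show 0 ≤ c by linarith)
  have e4 := Real.sq_sqrt (show 0 ≤ 1 - c by linarith)
  -- Both sides of the goal, once squared, are 4 plus twice a side of this inequality.
  have hprod : √(2 + t) * √(2 - t) ≤ 4 * (√c * √(1 - c)) := by
    rw [← Real.sqrt_mul (by linarith), ← Real.sqrt_mul (by linarith)]
    refine Real.sqrt_le_iff.2 ⟨by positivity, ?_⟩
    rw [mul_pow, Real.sq_sqrt (mul_nonneg (by linarith) (by linarith))]
    nlinarith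
  refine abs_le_of_sq_le_sq' ?_ (by positivity) |>.2
  nlinarith

/-- Squaring twice turns the hypothesis into t² ≤ β²(8 - β²)/4; β ≥ 2 keeps β² - 4 nonnegative for
the second squaring. -/
lemma le_half_add_of_two_le {β t : ℝ} (ht0 : 0 ≤ t) (ht : t ≤ 2) (hβ : 2 ≤ β)
    (h : β ≤ √(2 + t) + √(2 - t)) : 1 / 2 + t / 4 ≤ 1 / 2 + β / 8 * √(8 - β ^ 2) := by
  have e1 := Real.sq_sqrt (show 0 ≤ 2 + t by linarith)
  have e2 := Real.sq_sqrt (show 0 ≤ 2 - t by linarith)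
  set u := √(2 + t)
  set v := √(2 - t)
  have hu : 0 ≤ u := Real.sqrt_nonneg _
  have hv : 0 ≤ v := Real.sqrt_nonneg _
  have h1 : β ^ 2 - 4 ≤ 2 * (u * v) := by nlinarith
  have h2 : (β ^ 2 - 4) ^ 2 ≤ 4 * (4 - t ^ 2) := by
    have h3 : 0 ≤ β ^ 2 - 4 := by nlinarith
    have h4 := pow_le_pow_left₀ h3 h1 2
    have h5 : (2 * (u * v)) ^ 2 = 4 * (u ^ 2 * v ^ 2) := by ring
    rw [h5, e1, e2] at h4
    linarith
  have h8 : t ≤ √(β ^ 2 / 4 * (8 - β ^ 2)) := Real.le_sqrt_of_sq_le (by nlinarith)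
  rw [Real.sqrt_mul (by positivity), Real.sqrt_div' _ (by norm_num),
    Real.sqrt_sq (by linarith), show (4 : ℝ) = 2 ^ 2 by norm_num,
    Real.sqrt_sq zero_le_two] at h8
  linarith

theorem theorem3 {a d : Type*} [Fintype a] [DecidableEq a] [Fintype d] [DecidableEq d]
    (ρA : Matrix a a ℂ) (hρA : IsQState ρA)
    (X Y : Fin 2 → Matrix a a ℂ) (hX : IsMeasurement X) (hY : IsMeasurement Y)
    (ρAD : Matrix (a × d) (a × d) ℂ) (hρAD : IsQState ρAD)
    (hext : partialTraceRight ρAD = ρA)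
    (R S : Fin 2 → Matrix d d ℂ) (hR : IsMeasurement R) (hS : IsMeasurement S) :
    effectiveOverlap ρA X Y ∈ Set.Icc (0 : ℝ) 1 ∧
    chshValue ρAD X Y R S ≤
      2 * (√(effectiveOverlap ρA X Y) + √(1 - effectiveOverlap ρA X Y)) ∧
    (2 ≤ chshValue ρAD X Y R S →
      effectiveOverlap ρA X Y ≤
        1 / 2 + chshValue ρAD X Y R S / 8 * √(8 - chshValue ρAD X Y R S ^ 2)) := by
  obtain ⟨t, ht0, ht2, hc, hβ⟩ := exists_effectiveOverlap_le hρA hX hY hρAD hext hR hS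
  refine ⟨⟨effectiveOverlap_nonneg hρA.posSemidef X Y, by linarith⟩, ?_, fun h =>
    hc.trans (le_half_add_of_two_le ht0 ht2 h hβ)⟩
  rcases le_total (1 / 2) (effectiveOverlap ρA X Y) with h | h
  · exact hβ.trans (sqrt_add_sqrt_le_of_half_le h hc ht2)
  · have h1 := chshValue_le_four_mul_sqrt_effectiveOverlap hρA hX hY hρAD hext hR hS
    have h2 : √(effectiveOverlap ρA X Y) ≤ √(1 - effectiveOverlap ρA X Y) :=
      Real.sqrt_le_sqrt (by linarith)
    linarith
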